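/- Let $m\ge 0$ and $n=2^m$. A vector $a=(a_1,\dots,a_m)\in\mathbb F_2^m$ stands for the number $z=\sum_{i=1}^m 2^{i-1}(1-a_i)\in\{0,\dots,n-1\}$ and for the monomial $x_1^{a_1}\cdots x_m^{a_m}$. For monomials of equal degree put $x_{i_1}\cdots x_{i_t}\preccurlyeq x_{j_1}\cdots x_{j_t}$ (indices increasing) iff $i_l\le j_l$ for all $l$; in general $f\preccurlyeq g$ iff $f\preccurlyeq g'$ for some divisor $g'$ of $g$ of the same degree as $f$. Let $\mathcal I$ be a decreasing set of monomials ($f\in\mathcal I$ and $g\preccurlyeq f$ imply $g\in\mathcal I$), regarded also as a subset of $\{0,\dots,n-1\}$, and let $C(\mathcal I)\subseteq\mathbb F_2^n$ be the code spanned by the evaluations on $\mathbb F_2^m$ of the monomials in $\mathcal I$. The successive cancellation decoder $\mathrm{SC}_{\mathcal I}:\mathbb R^n\to\mathbb F_2^n$ maps $y=(L_{i,m})_i$ to $(u_{i,m})_i$, where, for every $0\le t<m$ and every $i$ whose binary digit of weight $2^t$ is $0$, $$L_{i,t}=\log\frac{e^{L_{i,t+1}+L_{i+2^t,t+1}}+1}{e^{L_{i,t+1}}+e^{L_{i+2^t,t+1}}},\qquad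 L_{i+2^t,t}=(-1)^{u_{i,t}}L_{i,t+1}+L_{i+2^t,t+1},$$ $$u_{i,t+1}=u_{i,t}\oplus u_{i+2^t,t},\qquad u_{i+2^t,t+1}=u_{i+2^t,t},$$ and $u_{i,0}=1$ if $i\in\mathcal I$ and $L_{i,0}<0$, and $u_{i,0}=0$ otherwise. Call $y$ tie-free if $L_{i,0}\ne 0$ for all $i\in\mathcal I$. A permutation $\pi$ of the positions $\mathbb F_2^m$ acts on words by $\pi(y)=(y_{\pi(i)})_i$. It is an affine automorphism of $C(\mathcal I)$ if $\pi(a)=Ma+b$ with $M\in GL_m(\mathbb F_2)$, $b\in\mathbb F_2^m$, and $\pi(c)\in C(\mathcal I)$ for all $c\in C(\mathcal I)$. Let $[\mathbb 1]_{\mathcal I}$ be the set of all affine automorphisms $\pi$ of $C(\mathcal I)$ such that $\pi^{-1}(\mathrm{SC}_{\mathcal I}(\pi(y)))=\mathrm{SC}_{\mathcal I}(y)$ for all $y\in\mathbb R^n$ for which $y$ and $\pi(y)$ are tie-free (the affine automorphisms that commute with $\mathrm{SC}_{\mathcal I}$). Then there are positive integers $s_1,\dots,s_l$ with $s_1+\cdots+s_l=m$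 such that $$[\mathbb 1]_{\mathcal I}=\mathrm{BLTA}([s_1,\dots,s_l]),$$ the group of all maps $a\mapsto Ma+b$ with $b\in\mathbb F_2^m$ and $M\in GL_m(\mathbb F_2)$ block lower-triangular with diagonal blocks of sizes $s_1\times s_1,\dots,s_l\times s_l$ (in this order). -/

import Mathlib

namespace PolarSC

/-- `𝔽₂ᵐ`.  The coordinate `a_i` (`1 ≤ i ≤ m`) of the text is `a (i - 1)` here, so `a_1` is the
least significant bit.  A vector `a` stands at the same time for the number
`z = ∑ i, 2 ^ (i - 1) * (1 - a_i)` in `{0, …, 2 ^ m - 1}` (a position in a word of length `2 ^ m`,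
or an index of a row of `G_m`) and for the monomial `x_1 ^ a_1 ⋯ x_m ^ a_m`. -/
abbrev V (m : ℕ) : Type := Fin m → ZMod 2

/-! ### Monomial codes -/

/-- The evaluation vector of the monomial `x_1 ^ a_1 ⋯ x_m ^ a_m`. -/
def evalMonomial {m : ℕ} (a : V m) : V m → ZMod 2 :=
  fun p => ∏ i, p i ^ (a i).val

/-- The code `C(I)`, the linear span of the evaluations of the monomials in `I`. -/
def code {m : ℕ} (I : Set (V m)) : Submodule (ZMod 2) (V m → ZMod 2) :=
  Submodule.span (ZMod 2) (evalMonomial '' I)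

/-- The set of the variables that occur in the monomial `a`. -/
def vars {m : ℕ} (a : V m) : Finset (Fin m) :=
  Finset.univ.filter (fun i => a i = 1)

/-- The order on monomials of the same degree, each one given by its set of variables:
`x_{i_1} ⋯ x_{i_t} ≼ x_{j_1} ⋯ x_{j_t}` iff `i_l ≤ j_l` for all `l`, where `i_1 < ⋯ < i_t` and
`j_1 < ⋯ < j_t`. -/
def SameDegreeLE {m : ℕ} (S T : Finset (Fin m)) : Prop :=
  ∃ h : S.card = T.card,
    ∀ l : Fin T.card, S.orderEmbOfFin h l ≤ T.orderEmbOfFin rfl l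

/-- `f ≼ g` iff `f ≼ g'` (in the order above) for some divisor `g'` of `g`. -/
def MonomialLE {m : ℕ} (f g : V m) : Prop :=
  ∃ g' : V m, vars g' ⊆ vars g ∧ SameDegreeLE (vars f) (vars g')

/-- Decreasing information sets. -/
def IsDecreasing {m : ℕ} (I : Set (V m)) : Prop :=
  ∀ f g : V m, MonomialLE g f → f ∈ I → g ∈ I

/-! ### Affine automorphisms -/

/-- The permutation `a ↦ M a + b` of `𝔽₂ᵐ`. -/
def affinePerm {m : ℕ} (M : Matrix.GeneralLinearGroup (Fin m) (ZMod 2)) (b : V m) :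
    Equiv.Perm (V m) where
  toFun a := M.1.mulVec a + b
  invFun a := (M⁻¹).1.mulVec (a - b)
  left_inv a := by
    simp only [add_sub_cancel_right, Matrix.mulVec_mulVec, ← Units.val_mul, inv_mul_cancel,
      Units.val_one, Matrix.one_mulVec]
  right_inv a := by
    simp only [Matrix.mulVec_mulVec, ← Units.val_mul, mul_inv_cancel, Units.val_one,
      Matrix.one_mulVec, sub_add_cancel]

/-- `π` is an automorphism of `C(I)`: `π(c) = (c_{π(0)}, …, c_{π(n-1)})` is a codeword for every
codeword `c`. -/
def IsAutomorphism {m : ℕ} (I : Set (V m)) (π : Equiv.Perm (V m)) : Prop :=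
  ∀ c ∈ code I, c ∘ π ∈ code I

/-- The affine automorphisms of `C(I)`. -/
def affineAut {m : ℕ} (I : Set (V m)) : Set (Equiv.Perm (V m)) :=
  {π | (∃ M b, π = affinePerm M b) ∧ IsAutomorphism I π}

/-- The group `BLTA([s_1, …, s_l])`, where `s_1 + ⋯ + s_l = m` and all `s_i` are positive: all
`(M, b)` with `M` invertible and zero above the diagonal blocks of sizes `s_1, …, s_l`
(`s.index i` is the number of the block that contains `i`).  As `M` is invertible, the diagonal
blocks have full rank. -/
def BLTA {m : ℕ} (s : Composition m) : Subgroup (Equiv.Perm (V m)) where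
  carrier := {π | ∃ (M : Matrix.GeneralLinearGroup (Fin m) (ZMod 2)) (b : V m),
    (∀ i j, s.index i < s.index j → M.1 i j = 0) ∧ π = affinePerm M b}
  one_mem' := by
    refine ⟨1, 0, ?_, ?_⟩
    · intro i j h
      exact Matrix.one_apply_ne (fun e => by simp [e] at h)
    · ext1 a
      simp [affinePerm]
  mul_mem' := by
    rintro _ _ ⟨M, b, hM, rfl⟩ ⟨N, c, hN, rfl⟩
    refine ⟨M * N, M.1.mulVec c + b, ?_, ?_⟩
    · intro i j h
      rw [Units.val_mul, Matrix.mul_apply]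
      refine Finset.sum_eq_zero fun k _ => ?_
      rcases lt_or_ge (s.index i) (s.index k) with hk | hk
      · rw [hM i k hk, zero_mul]
      · rw [hN k j (hk.trans_lt h), mul_zero]
    · ext1 a
      simp [affinePerm, Matrix.mulVec_add, add_assoc]
  inv_mem' := by
    rintro _ ⟨M, b, hM, rfl⟩
    refine ⟨M⁻¹, -(M⁻¹).1.mulVec b, ?_, ?_⟩
    · intro i j h
      have hT : M.1.BlockTriangular (fun i => OrderDual.toDual (s.index i)) :=
        fun i j h => hM i j h
      have hI := Matrix.blockTriangular_inv_of_blockTriangular hT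
      rw [Matrix.coe_units_inv]
      exact hI h
    · ext1 a
      change (M⁻¹).1.mulVec (a - b) = (M⁻¹).1.mulVec a + -(M⁻¹).1.mulVec b
      rw [Matrix.mulVec_sub, sub_eq_add_neg]

/-! ### Successive cancellation decoding -/

/-- `f(x, y) = log ((e^{x+y} + 1) / (e^x + e^y))`. -/
noncomputable def fLLR (x y : ℝ) : ℝ :=
  Real.log ((Real.exp (x + y) + 1) / (Real.exp x + Real.exp y))

/-- `g(u, x, y) = (-1)^u x + y`. -/
noncomputable def gLLR (u : ZMod 2) (x y : ℝ) : ℝ :=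
  (-1) ^ u.val * x + y

/-- The information set of the subcode on the positions whose last (most significant) coordinate
`a_m` is `c`: the upper half branch for `c = 1`, the lower half branch for `c = 0`. -/
def branch {m : ℕ} (I : Set (V (m + 1))) (c : ZMod 2) : Set (V m) :=
  {a | (Fin.snoc a c : V (m + 1)) ∈ I}

/-- The LLRs `f(L_i, L_{i + 2^m})` that are passed to the upper half branch. -/
noncomputable def upperLLR {m : ℕ} (y : V (m + 1) → ℝ) : V m → ℝ :=
  fun a => fLLR (y (Fin.snoc a 1 : V (m + 1))) (y (Fin.snoc a 0 : V (m + 1)))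

/-- The LLRs `g(u_i, L_i, L_{i + 2^m})` that are passed to the lower half branch, when `u` is the
hard decision of the upper half branch. -/
noncomputable def lowerLLR {m : ℕ} (u : V m → ZMod 2) (y : V (m + 1) → ℝ) : V m → ℝ :=
  fun a => gLLR (u a) (y (Fin.snoc a 1 : V (m + 1))) (y (Fin.snoc a 0 : V (m + 1)))

open Classical in
/-- The successive cancellation decoder `SC_I`.  At stage `0` a single bit is decided; at stage
`m + 1` the upper half branch is decoded (hard decisions `u`), then the lower one (hard decisions
`v`), and the hard decisions `(u + v, v)` are passed on. -/
noncomputable def sc : {m : ℕ} → Set (V m) → (V m → ℝ) → (V m → ZMod 2)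
  | 0, I, y => fun a => if a ∈ I ∧ y a < 0 then 1 else 0
  | m + 1, I, y =>
    let u := sc (branch I 1) (upperLLR y)
    let v := sc (branch I 0) (lowerLLR u y)
    fun a => if a (Fin.last m) = 1 then u (Fin.init a) + v (Fin.init a) else v (Fin.init a)

/-- The LLRs `L_{i,0}` at stage `0`, on which the bit decisions of `SC_I` are based when `y` is
received. -/
noncomputable def stageZeroLLR : {m : ℕ} → Set (V m) → (V m → ℝ) → (V m → ℝ)
  | 0, _, y => y
  | m + 1, I, y =>
    let u := sc (branch I 1) (upperLLR y)
    fun a => if a (Fin.last m) = 1 then stageZeroLLR (branch I 1) (upperLLR y) (Fin.init a)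
      else stageZeroLLR (branch I 0) (lowerLLR u y) (Fin.init a)

/-- No tie occurs when `SC_I` decodes `y`: no information bit is decided on an LLR equal to `0`. -/
def TieFree {m : ℕ} (I : Set (V m)) (y : V m → ℝ) : Prop :=
  ∀ a ∈ I, stageZeroLLR I y a ≠ 0

/-- `π ∼_I π'`: permuted decoding with `π` and with `π'`, that is `π⁻¹(SC_I(π(y)))` and
`π'⁻¹(SC_I(π'(y)))`, agree for all `y` (such that neither decoding meets a tie). -/
def SCEquiv {m : ℕ} (I : Set (V m)) (π π' : Equiv.Perm (V m)) : Prop :=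
  ∀ y : V m → ℝ, TieFree I (y ∘ π) → TieFree I (y ∘ π') →
    sc I (y ∘ π) ∘ π.symm = sc I (y ∘ π') ∘ π'.symm

/-- The class `[π]_I` of the affine automorphisms of `C(I)` that are equivalent to `π`. -/
def scClass {m : ℕ} (I : Set (V m)) (π : Equiv.Perm (V m)) : Set (Equiv.Perm (V m)) :=
  {π' | π' ∈ affineAut I ∧ SCEquiv I π' π}

/-- `π` commutes with `SC_I`. -/
def CommutesWithSC {m : ℕ} (I : Set (V m)) (π : Equiv.Perm (V m)) : Prop :=
  ∀ y : V m → ℝ, TieFree I y → TieFree I (y ∘ π) → sc I (y ∘ π) = sc I y ∘ π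

/-- `[1]_I` consists of the affine automorphisms that commute with `SC_I`. -/
theorem mem_scClass_one_iff {m : ℕ} (I : Set (V m)) (π : Equiv.Perm (V m)) :
    π ∈ scClass I 1 ↔ π ∈ affineAut I ∧ CommutesWithSC I π := by
  refine and_congr_right fun _ => ⟨fun h y h1 h2 => ?_, fun h y h2 h1 => ?_⟩
  · exact (Equiv.comp_symm_eq π _ _).1 (h y h2 h1)
  · exact (Equiv.comp_symm_eq π _ _).2 (h y h1 h2)

end PolarSC

/-!
The permutations in `[1]_I` form a group that contains all lower triangular affine maps, and every
group of affine permutations of `𝔽₂ᵐ` with this property is some `BLTA s`.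

*Closure under products* (`commutesWithSC_mul`).  If `π` and `ρ` commute with `SC_I`, and `y` and
`y ∘ (π * ρ)` are tie-free, then `y ∘ π` may still have a tie.  But `SC_I` is locally constant at
tie-free words (`eventually_sc_eq`), and tie-free words contain an open dense set
(`dense_generic`): for prescribed decisions the LLRs at stage `0` are real analytic functions of `y`
that do not vanish identically, because they are nonzero if the signs of `y` agree with these
decisions (`genieLLR_ne_zero`).  So `y` can be moved to a nearby word without any tie.

*Lower triangular maps* (`sc_comp_lower`), by induction on `m`.  Such a map acts on the first
coordinates by a lower triangular map `p'`, and adds an affine function `ℓ` of them to the last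
coordinate.  As `f` is symmetric, the upper branch is decoded to `u ∘ p'`.  Where `ℓ = 1`, the
inputs of `g` are exchanged, which multiplies its value by `(-1)^u`; so the lower branch receives its
former LLRs, permuted by `p'` and changed by the signs of `ℓ * (u ∘ p')`.  For decreasing `I`, this
word belongs to the code of the lower branch (`affine_mul_mem_code`), and `SC` is equivariant under
the addition of codewords (`sc_sgn_mul`).

*Groups that contain the lower triangular maps* (`exists_eq_BLTA`).  Over `𝔽₂`, the Bruhat
decomposition (`exists_permMatrix_mem`) reduces an inclusion between two such groups to permutation
matrices.  Sorting a permutation by transpositions at inversions reduces it further to elementary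
matrices (`le_of_transvection_mem`), as conjugation by the permutation turns a lower elementary
matrix into the upper one at the inversion.  The elementary matrices in the group determine the
block boundaries.
-/

namespace PolarSC

theorem zmod_two_cases (z : ZMod 2) : z = 0 ∨ z = 1 := by revert z; decide

section Generic

open Filter Topology

/-! ### Regularity of the LLR recursion -/

theorem continuous_fLLR : Continuous fun p : ℝ × ℝ => fLLR p.1 p.2 := by
  unfold fLLR
  refine Continuous.log ?_ fun p => by positivity
  exact Continuous.div (by fun_prop) (by fun_prop) fun p => by positivity

theorem continuous_upperLLR {m : ℕ} : Continuous (upperLLR (m := m)) := by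
  refine continuous_pi fun a => ?_
  exact continuous_fLLR.comp (by fun_prop :
    Continuous fun y : V (m + 1) → ℝ => (y (Fin.snoc a 1), y (Fin.snoc a 0)))

theorem continuous_lowerLLR {m : ℕ} (u : V m → ZMod 2) : Continuous (lowerLLR u) := by
  refine continuous_pi fun a => ?_
  unfold lowerLLR gLLR
  fun_prop

theorem analyticAt_upperLLR {m : ℕ} (y : V (m + 1) → ℝ) : AnalyticAt ℝ (upperLLR (m := m)) y := by
  refine AnalyticAt.pi fun a => ?_
  have h (p : V (m + 1)) : AnalyticAt ℝ (fun y : V (m + 1) → ℝ => y p) y :=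
    (ContinuousLinearMap.proj (R := ℝ) (φ := fun _ : V (m + 1) => ℝ) p).analyticAt y
  refine AnalyticAt.fun_comp (g := Real.log) (analyticAt_log ?_) (AnalyticAt.div ?_ ?_ ?_)
  · exact div_pos (add_pos (Real.exp_pos _) one_pos) (add_pos (Real.exp_pos _) (Real.exp_pos _))
  · exact ((h _).add (h _)).rexp.add analyticAt_const
  · exact (h _).rexp.add (h _).rexp
  · exact (add_pos (Real.exp_pos _) (Real.exp_pos _)).ne'

theorem analyticAt_lowerLLR {m : ℕ} (u : V m → ZMod 2) (y : V (m + 1) → ℝ) :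
    AnalyticAt ℝ (lowerLLR u) y := by
  refine AnalyticAt.pi fun a => ?_
  have h (p : V (m + 1)) : AnalyticAt ℝ (fun y : V (m + 1) → ℝ => y p) y :=
    (ContinuousLinearMap.proj (R := ℝ) (φ := fun _ : V (m + 1) => ℝ) p).analyticAt y
  exact (analyticAt_const.mul (h _)).add (h _)

/-! ### The Plotkin decomposition and decoding with prescribed decisions -/

/-- If `w = (u + v, v)`, this is the part `u` that the upper half branch decides. -/
def upperPart {m : ℕ} (w : V (m + 1) → ZMod 2) : V m → ZMod 2 :=
  fun a => w (Fin.snoc a 1 : V (m + 1)) + w (Fin.snoc a 0 : V (m + 1))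

/-- If `w = (u + v, v)`, this is the part `v` that the lower half branch decides. -/
def lowerPart {m : ℕ} (w : V (m + 1) → ZMod 2) : V m → ZMod 2 :=
  fun a => w (Fin.snoc a 0 : V (m + 1))

/-- The LLRs at stage `0` when the hard decisions are not taken from the LLRs but prescribed, in
such a way that the decoder outputs `w`. -/
noncomputable def genieLLR : {m : ℕ} → (V m → ZMod 2) → (V m → ℝ) → (V m → ℝ)
  | 0, _, y => y
  | _ + 1, w, y => fun a =>
    if a (Fin.last _) = 1 then genieLLR (upperPart w) (upperLLR y) (Fin.init a)
    else genieLLR (lowerPart w) (lowerLLR (upperPart w) y) (Fin.init a)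

theorem sc_snoc {m : ℕ} (I : Set (V (m + 1))) (y : V (m + 1) → ℝ) (a : V m) (z : ZMod 2) :
    sc I y (Fin.snoc a z : V (m + 1)) = z * sc (branch I 1) (upperLLR y) a +
      sc (branch I 0) (lowerLLR (sc (branch I 1) (upperLLR y)) y) a := by
  rcases zmod_two_cases z with rfl | rfl <;> simp [sc]

theorem lowerPart_sc {m : ℕ} (I : Set (V (m + 1))) (y : V (m + 1) → ℝ) :
    lowerPart (sc I y) = sc (branch I 0) (lowerLLR (sc (branch I 1) (upperLLR y)) y) := by
  funext a; simp [lowerPart, sc_snoc]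

theorem upperPart_sc {m : ℕ} (I : Set (V (m + 1))) (y : V (m + 1) → ℝ) :
    upperPart (sc I y) = sc (branch I 1) (upperLLR y) := by
  funext a
  simp only [upperPart, sc_snoc, one_mul, zero_mul, zero_add, add_assoc, CharTwo.add_self_eq_zero,
    add_zero]

/-- The LLRs of `SC_I` are those with the output of `SC_I` prescribed. -/
theorem genieLLR_sc {m : ℕ} (I : Set (V m)) (y : V m → ℝ) :
    genieLLR (sc I y) y = stageZeroLLR I y := by
  induction m with
  | zero => rfl
  | succ m ih =>
    funext a
    simp only [genieLLR, stageZeroLLR, upperPart_sc, lowerPart_sc, ih]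

theorem analyticAt_genieLLR {m : ℕ} (w : V m → ZMod 2) (a : V m) (y : V m → ℝ) :
    AnalyticAt ℝ (fun y => genieLLR w y a) y := by
  induction m with
  | zero => exact (ContinuousLinearMap.proj (R := ℝ) (φ := fun _ : V 0 => ℝ) a).analyticAt y
  | succ m ih =>
    simp only [genieLLR]
    split
    · exact (ih (upperPart w) (Fin.init a) (upperLLR y)).comp (analyticAt_upperLLR y)
    · exact (ih (lowerPart w) (Fin.init a) (lowerLLR (upperPart w) y)).comp
        (analyticAt_lowerLLR _ y)

/-! ### Signs -/

/-- The sign `(-1) ^ c` of a bit. -/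
def sgn (c : ZMod 2) : ℝ := (-1) ^ c.val

@[simp] theorem sgn_zero : sgn 0 = 1 := by simp [sgn]

@[simp] theorem sgn_one : sgn 1 = -1 := by simp [sgn, ZMod.val_one]

theorem sgn_add (a b : ZMod 2) : sgn (a + b) = sgn a * sgn b := by
  rcases zmod_two_cases a with rfl | rfl <;> rcases zmod_two_cases b with rfl | rfl <;>
    simp [CharTwo.add_self_eq_zero]

theorem sgn_mul_self (a : ZMod 2) : sgn a * sgn a = 1 := by
  rw [← sgn_add, CharTwo.add_self_eq_zero, sgn_zero]

theorem sgn_ne_zero (a : ZMod 2) : sgn a ≠ 0 := left_ne_zero_of_mul_eq_one (sgn_mul_self a)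

theorem fLLR_comm (x y : ℝ) : fLLR x y = fLLR y x := by
  simp only [fLLR, add_comm]

theorem fLLR_neg (x y : ℝ) : fLLR (-x) y = -fLLR x y := by
  unfold fLLR
  rw [← Real.log_inv, inv_div]
  congr 1
  rw [div_eq_div_iff (by positivity) (by positivity)]
  simp only [Real.exp_add, Real.exp_neg]
  field_simp
  ring

theorem fLLR_sgn_mul (a b : ZMod 2) (x y : ℝ) :
    fLLR (sgn a * x) (sgn b * y) = sgn (a + b) * fLLR x y := by
  have h (c : ZMod 2) (x y : ℝ) : fLLR (sgn c * x) y = sgn c * fLLR x y := by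
    rcases zmod_two_cases c with rfl | rfl <;> simp [fLLR_neg]
  rw [h, fLLR_comm, h, fLLR_comm, sgn_add, mul_assoc]

theorem fLLR_pos {x y : ℝ} (hx : 0 < x) (hy : 0 < y) : 0 < fLLR x y := by
  refine Real.log_pos ?_
  rw [one_lt_div (by positivity), Real.exp_add]
  nlinarith [Real.one_lt_exp_iff.2 hx, Real.one_lt_exp_iff.2 hy]

theorem gLLR_eq (u : ZMod 2) (x y : ℝ) : gLLR u x y = sgn u * x + y := rfl

/-! ### Density of the tie-free words, and products of commuting permutations -/

/-- LLRs whose signs agree with the prescribed decisions stay nonzero down to stage `0`. -/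
theorem genieLLR_ne_zero {m : ℕ} (w : V m → ZMod 2) (y : V m → ℝ)
    (h : ∀ p, 0 < sgn (w p) * y p) (a : V m) : genieLLR w y a ≠ 0 := by
  induction m with
  | zero => exact right_ne_zero_of_mul (h a).ne'
  | succ m ih =>
    simp only [genieLLR]
    split
    · refine ih _ _ (fun p => ?_) _
      rw [upperPart, upperLLR, ← fLLR_sgn_mul]
      exact fLLR_pos (h _) (h _)
    · refine ih _ _ (fun p => ?_) _
      have e : sgn (lowerPart w p) * lowerLLR (upperPart w) y p =
          (sgn (lowerPart w p) * sgn (lowerPart w p)) *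
            (sgn (w (Fin.snoc p 1 : V (m + 1))) * y (Fin.snoc p 1 : V (m + 1))) +
          sgn (w (Fin.snoc p 0 : V (m + 1))) * y (Fin.snoc p 0 : V (m + 1)) := by
        simp only [lowerLLR, gLLR_eq, upperPart, lowerPart, sgn_add]
        ring
      rw [e, sgn_mul_self, one_mul]
      exact add_pos (h _) (h _)

/-- Words for which no LLR at stage `0` vanishes, whatever the decisions are. -/
def Generic {m : ℕ} : Set (V m → ℝ) := ⋂ (w : V m → ZMod 2) (a : V m), {y | genieLLR w y a ≠ 0}

theorem tieFree_of_mem_generic {m : ℕ} (I : Set (V m)) {y : V m → ℝ} (hy : y ∈ Generic) :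
    TieFree I y := fun a _ => by
  rw [← genieLLR_sc]
  exact Set.mem_iInter₂.1 hy _ _

theorem isOpen_genieLLR_ne_zero {m : ℕ} (w : V m → ZMod 2) (a : V m) :
    IsOpen {y : V m → ℝ | genieLLR w y a ≠ 0} := by
  have : Continuous fun y => genieLLR w y a :=
    continuous_iff_continuousAt.2 fun y => (analyticAt_genieLLR w a y).continuousAt
  exact isOpen_ne_fun this continuous_const

/-- The zeros of a real analytic function that does not vanish identically have no interior. -/
theorem dense_genieLLR_ne_zero {m : ℕ} (w : V m → ZMod 2) (a : V m) :
    Dense {y : V m → ℝ | genieLLR w y a ≠ 0} := by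
  rw [← Set.compl_ofPred, ← interior_eq_empty_iff_dense_compl, Set.eq_empty_iff_forall_notMem]
  intro z hz
  have h0 : (fun y => genieLLR w y a) =ᶠ[𝓝 z] 0 := mem_interior_iff_mem_nhds.1 hz
  have := AnalyticOnNhd.eqOn_zero_of_preconnected_of_eventuallyEq_zero
    (fun y _ => analyticAt_genieLLR w a y) isPreconnected_univ (Set.mem_univ z) h0
  exact genieLLR_ne_zero w (fun p => sgn (w p)) (fun p => by simp [sgn_mul_self]) a
    (this (Set.mem_univ _))

theorem isOpen_generic {m : ℕ} : IsOpen (Generic (m := m)) :=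
  isOpen_iInter_of_finite fun w => isOpen_iInter_of_finite fun a => isOpen_genieLLR_ne_zero w a

theorem dense_generic {m : ℕ} : Dense (Generic (m := m)) :=
  dense_iInter_of_isOpen
    (fun w => isOpen_iInter_of_finite fun a => isOpen_genieLLR_ne_zero w a)
    fun w => dense_iInter_of_isOpen (isOpen_genieLLR_ne_zero w) (dense_genieLLR_ne_zero w)

theorem tieFree_succ {m : ℕ} (I : Set (V (m + 1))) (y : V (m + 1) → ℝ) :
    TieFree I y ↔ TieFree (branch I 1) (upperLLR y) ∧
      TieFree (branch I 0) (lowerLLR (sc (branch I 1) (upperLLR y)) y) := by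
  refine ⟨fun h => ⟨fun a ha => ?_, fun a ha => ?_⟩, fun h a ha => ?_⟩
  · simpa [stageZeroLLR] using h _ ha
  · simpa [stageZeroLLR] using h _ ha
  · rcases zmod_two_cases (a (Fin.last m)) with ha' | ha'
    · simp only [stageZeroLLR, ha', zero_ne_one, if_false]
      exact h.2 _ (by rw [branch, Set.mem_ofPred, ← ha', Fin.snoc_init_self]; exact ha)
    · simp only [stageZeroLLR, ha', if_true]
      exact h.1 _ (by rw [branch, Set.mem_ofPred, ← ha', Fin.snoc_init_self]; exact ha)

/-- `SC_I` is locally constant at the tie-free words. -/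
theorem eventually_sc_eq {m : ℕ} {I : Set (V m)} {y : V m → ℝ} (hy : TieFree I y) :
    ∀ᶠ y' in 𝓝 y, sc I y' = sc I y := by
  induction m with
  | zero =>
    obtain ⟨p⟩ : Nonempty (V 0) := ⟨default⟩
    by_cases ha : p ∈ I
    · have hc : ContinuousAt (fun y' : V 0 → ℝ => y' p) y := (continuous_apply p).continuousAt
      rcases lt_or_gt_of_ne (hy _ ha : y p ≠ 0) with h | h
      · filter_upwards [hc.eventually_lt_const h] with y' hy'
        funext a
        obtain rfl := Subsingleton.elim p a
        simp only [sc, ha, hy', show y p < 0 from h]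
      · filter_upwards [hc.eventually_const_lt h] with y' hy'
        funext a
        obtain rfl := Subsingleton.elim p a
        simp only [sc, hy'.not_gt, show ¬ y p < 0 from lt_asymm h, and_false]
    · refine Eventually.of_forall fun y' => ?_
      funext a
      obtain rfl := Subsingleton.elim p a
      simp [sc, ha]
  | succ m ih =>
    obtain ⟨h1, h2⟩ := (tieFree_succ I y).1 hy
    filter_upwards [continuous_upperLLR.continuousAt.eventually (ih h1),
      (continuous_lowerLLR _).continuousAt.eventually (ih h2)] with y' e1 e2
    funext a
    simp only [sc, e1, e2]

theorem continuous_precomp {m : ℕ} (π : Equiv.Perm (V m)) :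
    Continuous fun y : V m → ℝ => y ∘ π := by
  fun_prop

/-- Commuting with `SC_I` is stable under products. -/
theorem commutesWithSC_mul {m : ℕ} {I : Set (V m)} {π ρ : Equiv.Perm (V m)}
    (hπ : CommutesWithSC I π) (hρ : CommutesWithSC I ρ) : CommutesWithSC I (π * ρ) := by
  intro y hy hy'
  -- The word `y ∘ π` may have a tie, so `y` is replaced by a nearby word `z` for which `z`, `z ∘ π`
  -- and `z ∘ (π * ρ)` are generic; `SC_I` does not see the change at `y` and at `y ∘ (π * ρ)`.
  let e := Homeomorph.piCongrLeft (Y := fun _ : V m => ℝ) π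
  have he (z : V m → ℝ) : e.symm z = z ∘ π := rfl
  let e' := Homeomorph.piCongrLeft (Y := fun _ : V m => ℝ) (π * ρ)
  have he' (z : V m → ℝ) : e'.symm z = z ∘ (π * ρ : Equiv.Perm (V m)) := rfl
  have hd : Dense (Generic ∩ (e.symm ⁻¹' Generic ∩ e'.symm ⁻¹' Generic)) := by
    refine Dense.inter_of_isOpen_left dense_generic (Dense.inter_of_isOpen_left ?_ ?_ ?_)
      isOpen_generic
    · exact dense_generic.preimage e.symm.isOpenMap
    · exact dense_generic.preimage e'.symm.isOpenMap
    · exact isOpen_generic.preimage e.symm.continuous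
  have h1 : ∀ᶠ z in 𝓝 y, sc I z = sc I y := eventually_sc_eq hy
  have h2 : ∀ᶠ z in 𝓝 y, sc I (z ∘ (π * ρ : Equiv.Perm (V m))) =
      sc I (y ∘ (π * ρ : Equiv.Perm (V m))) :=
    (continuous_precomp _).continuousAt.eventually (eventually_sc_eq hy')
  obtain ⟨z, ⟨hz1, hz2⟩, hz⟩ := mem_closure_iff_nhds.1 (hd y) _ (h1.and h2)
  have t1 := tieFree_of_mem_generic I hz.1
  have t2 : TieFree I (z ∘ π) := tieFree_of_mem_generic I hz.2.1
  have t3 : TieFree I ((z ∘ π) ∘ ρ) := tieFree_of_mem_generic I hz.2.2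
  rw [← hz1, ← hz2]
  calc sc I ((z ∘ π) ∘ ρ) = sc I (z ∘ π) ∘ ρ := hρ _ t2 t3
    _ = sc I z ∘ π ∘ ρ := by rw [hπ _ t1 t2]; rfl

end Generic

/-! ### The code and its two branches -/

theorem evalMonomial_snoc {m : ℕ} (a p : V m) (z w : ZMod 2) :
    evalMonomial (Fin.snoc a z : V (m + 1)) (Fin.snoc p w : V (m + 1)) =
      evalMonomial a p * w ^ z.val := by
  simp [evalMonomial, Fin.prod_univ_castSucc]

theorem upperPart_mem_and_lowerPart_mem_of_mem_code {m : ℕ} {I : Set (V (m + 1))}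
    {c : V (m + 1) → ZMod 2} (hc : c ∈ code I) :
    upperPart c ∈ code (branch I 1) ∧ lowerPart c ∈ code (branch I 0) := by
  unfold code at hc
  induction hc using Submodule.span_induction with
  | mem c hc =>
    obtain ⟨f, hf, rfl⟩ := hc
    rw [← Fin.snoc_init_self f] at hf ⊢
    rcases zmod_two_cases (f (Fin.last m)) with hz | hz
    · rw [hz] at hf ⊢
      have h1 : upperPart (evalMonomial (Fin.snoc (Fin.init f) 0 : V (m + 1))) = 0 := by
        funext a; simp [upperPart, evalMonomial_snoc, CharTwo.add_self_eq_zero]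
      have h0 : lowerPart (evalMonomial (Fin.snoc (Fin.init f) 0 : V (m + 1))) =
          evalMonomial (Fin.init f) := by
        funext a; simp [lowerPart, evalMonomial_snoc]
      rw [h1, h0]
      exact ⟨Submodule.zero_mem _, Submodule.subset_span ⟨_, hf, rfl⟩⟩
    · rw [hz] at hf ⊢
      have h1 : upperPart (evalMonomial (Fin.snoc (Fin.init f) 1 : V (m + 1))) =
          evalMonomial (Fin.init f) := by
        funext a; simp [upperPart, evalMonomial_snoc, ZMod.val_one]
      have h0 : lowerPart (evalMonomial (Fin.snoc (Fin.init f) 1 : V (m + 1))) = 0 := by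
        funext a; simp [lowerPart, evalMonomial_snoc, ZMod.val_one]
      rw [h1, h0]
      exact ⟨Submodule.subset_span ⟨_, hf, rfl⟩, Submodule.zero_mem _⟩
  | zero =>
    have h1 : upperPart (0 : V (m + 1) → ZMod 2) = 0 := by funext a; simp [upperPart]
    exact ⟨h1 ▸ Submodule.zero_mem _, Submodule.zero_mem _⟩
  | add c d _ _ hc hd =>
    have h1 : upperPart (c + d) = upperPart c + upperPart d := by
      funext a; simp only [upperPart, Pi.add_apply]; ring
    exact ⟨h1 ▸ Submodule.add_mem _ hc.1 hd.1, Submodule.add_mem _ hc.2 hd.2⟩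
  | smul t c _ hc =>
    have h1 : upperPart (t • c) = t • upperPart c := by
      funext a; simp only [upperPart, Pi.smul_apply, smul_add]
    exact ⟨h1 ▸ Submodule.smul_mem _ t hc.1, Submodule.smul_mem _ t hc.2⟩

theorem last_mul_mem_code {m : ℕ} {I : Set (V (m + 1))} {u : V m → ZMod 2}
    (hu : u ∈ code (branch I 1)) : (fun a => a (Fin.last m) * u (Fin.init a)) ∈ code I := by
  unfold code at hu
  induction hu using Submodule.span_induction with
  | mem u hu =>
    obtain ⟨f, hf, rfl⟩ := hu
    refine Submodule.subset_span ⟨_, hf, ?_⟩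
    funext a
    rw [← Fin.snoc_init_self a, evalMonomial_snoc]
    simp [ZMod.val_one, mul_comm]
  | zero => simpa only [Pi.zero_apply, mul_zero] using! Submodule.zero_mem (code I)
  | add c d _ _ hc hd => simpa only [Pi.add_apply, mul_add] using! Submodule.add_mem _ hc hd
  | smul t c _ hc =>
    simpa only [Pi.smul_apply, smul_eq_mul, mul_left_comm] using! Submodule.smul_mem _ t hc

theorem comp_init_mem_code {m : ℕ} {I : Set (V (m + 1))} {v : V m → ZMod 2}
    (hv : v ∈ code (branch I 0)) : (fun a => v (Fin.init a)) ∈ code I := by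
  unfold code at hv
  induction hv using Submodule.span_induction with
  | mem u hu =>
    obtain ⟨f, hf, rfl⟩ := hu
    refine Submodule.subset_span ⟨_, hf, ?_⟩
    funext a
    rw [← Fin.snoc_init_self a, evalMonomial_snoc]
    simp
  | zero => exact Submodule.zero_mem (code I)
  | add c d _ _ hc hd => exact Submodule.add_mem _ hc hd
  | smul t c _ hc => exact Submodule.smul_mem _ t hc

theorem eq_upperPart_lowerPart {m : ℕ} (c : V (m + 1) → ZMod 2) (a : V m) (z : ZMod 2) :
    c (Fin.snoc a z : V (m + 1)) = z * upperPart c a + lowerPart c a := by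
  rcases zmod_two_cases z with rfl | rfl
  · simp [lowerPart]
  · simp [lowerPart, upperPart, add_assoc, CharTwo.add_self_eq_zero]

/-- The `(u + v, v)` construction of the code. -/
theorem mem_code_succ {m : ℕ} {I : Set (V (m + 1))} {c : V (m + 1) → ZMod 2} :
    c ∈ code I ↔ upperPart c ∈ code (branch I 1) ∧ lowerPart c ∈ code (branch I 0) := by
  refine ⟨upperPart_mem_and_lowerPart_mem_of_mem_code, fun h => ?_⟩
  have e : c = (fun a => a (Fin.last m) * upperPart c (Fin.init a)) +
      fun a => lowerPart c (Fin.init a) := by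
    funext a
    conv_lhs => rw [← Fin.snoc_init_self a]
    rw [eq_upperPart_lowerPart c]
    rfl
  rw [e]
  exact Submodule.add_mem _ (last_mul_mem_code h.1) (comp_init_mem_code h.2)

/-! ### Decreasing sets of monomials -/

/-- A set of monomials that is closed under the deletion of a variable and under the replacement
of a variable by one of smaller index.  In contrast to `IsDecreasing`, this passes to the branches
at sight. -/
structure ClosedUnderMoves {m : ℕ} (I : Set (V m)) : Prop where
  delete : ∀ a ∈ I, ∀ j, Function.update a j 0 ∈ I
  replace : ∀ a ∈ I, ∀ i j, i < j → a j = 1 → a i = 0 →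
    Function.update (Function.update a j 0) i 1 ∈ I

/-- Sorted sequences compare termwise as soon as some bijection lowers every element. -/
theorem sameDegreeLE_of_injOn {m : ℕ} {S T : Finset (Fin m)} (h : S.card = T.card)
    (f : Fin m → Fin m) (hf : ∀ t ∈ T, f t ∈ S) (hinj : Set.InjOn f T) (hle : ∀ t ∈ T, f t ≤ t) :
    SameDegreeLE S T := by
  refine ⟨h, fun l => ?_⟩
  by_contra! hl
  -- `f` maps the `l + 1` smallest elements of `T` to elements of `S` below the element number `l`.
  have hsub : (Finset.Iic l).image (fun k => f (T.orderEmbOfFin rfl k)) ⊆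
      (Finset.Iio l).image (S.orderEmbOfFin h) := by
    intro x hx
    obtain ⟨k, hk, rfl⟩ := Finset.mem_image.1 hx
    have hT := Finset.orderEmbOfFin_mem T rfl k
    obtain ⟨j, hj⟩ : f (T.orderEmbOfFin rfl k) ∈ Set.range (S.orderEmbOfFin h) := by
      rw [Finset.range_orderEmbOfFin]
      exact hf _ hT
    refine Finset.mem_image.2 ⟨j, ?_, hj⟩
    rw [Finset.mem_Iio, ← (S.orderEmbOfFin h).lt_iff_lt, hj]
    exact ((hle _ hT).trans ((T.orderEmbOfFin rfl).monotone (Finset.mem_Iic.1 hk))).trans_lt hl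
  have hcard := (Finset.card_le_card hsub).trans Finset.card_image_le
  rw [Finset.card_image_of_injective] at hcard
  · simp at hcard
  · intro k k' hk
    exact (T.orderEmbOfFin rfl).injective
      (hinj (Finset.orderEmbOfFin_mem T rfl k) (Finset.orderEmbOfFin_mem T rfl k') hk)

theorem mem_vars {m : ℕ} {a : V m} {i : Fin m} : i ∈ vars a ↔ a i = 1 := by
  simp [vars]

theorem IsDecreasing.closedUnderMoves {m : ℕ} {I : Set (V m)} (hI : IsDecreasing I) :
    ClosedUnderMoves I where
  delete a ha j := by
    refine hI a _ ⟨Function.update a j 0, fun i hi => ?_, rfl, fun l => le_rfl⟩ ha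
    rw [mem_vars] at hi ⊢
    rcases eq_or_ne i j with rfl | h
    · simp at hi
    · simpa [h] using hi
  replace a ha i j hij hj hi := by
    have e : vars (Function.update (Function.update a j 0) i 1) =
        (vars a).map (Equiv.swap i j).toEmbedding := by
      ext k
      rw [Finset.mem_map_equiv, mem_vars, mem_vars, Equiv.symm_swap]
      rcases eq_or_ne k i with rfl | h1
      · simp [hj]
      · rcases eq_or_ne k j with rfl | h2
        · simp [hi, h1]
        · simp [h1, h2, Equiv.swap_apply_of_ne_of_ne]
    refine hI a _ ⟨a, subset_rfl, sameDegreeLE_of_injOn ?_ (Equiv.swap i j) ?_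
      (Equiv.injective _).injOn fun t ht => ?_⟩ ha
    · rw [e, Finset.card_map]
    · intro t ht
      rw [e]
      exact Finset.mem_map_of_mem _ ht
    · rw [mem_vars] at ht
      rcases eq_or_ne t j with rfl | h
      · rw [Equiv.swap_apply_right]
        exact hij.le
      · rw [Equiv.swap_apply_of_ne_of_ne _ h]
        rintro rfl
        exact zero_ne_one (hi.symm.trans ht)

theorem ClosedUnderMoves.branch {m : ℕ} {I : Set (V (m + 1))} (hI : ClosedUnderMoves I)
    (z : ZMod 2) : ClosedUnderMoves (branch I z) where
  delete a ha j := by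
    have := hI.delete _ ha j.castSucc
    rwa [← Fin.snoc_update] at this
  replace a ha i j hij hj hi := by
    have := hI.replace _ ha i.castSucc j.castSucc (by simpa using hij) (by simpa using hj)
      (by simpa using hi)
    rwa [← Fin.snoc_update, ← Fin.snoc_update] at this

theorem ClosedUnderMoves.mem_branch_zero {m : ℕ} {I : Set (V (m + 1))} (hI : ClosedUnderMoves I)
    {a : V m} (ha : a ∈ PolarSC.branch I 1) : a ∈ PolarSC.branch I 0 := by
  have := hI.delete _ ha (Fin.last m)
  rwa [Fin.update_snoc_last] at this

theorem ClosedUnderMoves.update_mem_branch_zero {m : ℕ} {I : Set (V (m + 1))}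
    (hI : ClosedUnderMoves I) {a : V m} (ha : a ∈ PolarSC.branch I 1) (j : Fin m) :
    Function.update a j 1 ∈ PolarSC.branch I 0 := by
  rcases zmod_two_cases (a j) with h | h
  · have := hI.replace _ ha j.castSucc (Fin.last m) (Fin.castSucc_lt_last j) (by simp)
      (by simpa using h)
    rwa [Fin.update_snoc_last, ← Fin.snoc_update] at this
  · rw [← h, Function.update_eq_self]
    exact hI.mem_branch_zero ha

theorem evalMonomial_update_one {m : ℕ} (a p : V m) (j : Fin m) :
    evalMonomial (Function.update a j 1) p = p j * evalMonomial a p := by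
  have e : (fun i => p i ^ (Function.update a j 1 i).val) =
      Function.update (fun i => p i ^ (a i).val) j (p j) := by
    funext i
    rcases eq_or_ne i j with rfl | h
    · simp [ZMod.val_one]
    · simp [h]
  unfold evalMonomial
  rw [e, Finset.prod_update_of_mem (Finset.mem_univ j),
    Finset.prod_eq_mul_prod_sdiff_singleton_of_mem (Finset.mem_univ j) fun i => p i ^ (a i).val,
    ← mul_assoc]
  congr 1
  generalize p j = x
  generalize a j = y
  revert x y
  decide

/-- Multiplication by an affine function of the first `m` variables maps the code of the upper
half branch into the code of the lower half branch. -/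
theorem affine_mul_mem_code {m : ℕ} {I : Set (V (m + 1))} (hI : ClosedUnderMoves I)
    (t : Fin m → ZMod 2) (b : ZMod 2) {u : V m → ZMod 2} (hu : u ∈ code (branch I 1)) :
    (fun a => (∑ j, t j * a j + b) * u a) ∈ code (branch I 0) := by
  unfold code at hu
  induction hu using Submodule.span_induction with
  | mem u hu =>
    obtain ⟨f, hf, rfl⟩ := hu
    have e : (fun a => (∑ j, t j * a j + b) * evalMonomial f a) =
        ∑ j, t j • evalMonomial (Function.update f j 1) + b • evalMonomial f := by
      funext a
      simp only [Pi.add_apply, Finset.sum_apply, Pi.smul_apply, smul_eq_mul,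
        evalMonomial_update_one, add_mul, Finset.sum_mul, mul_assoc]
    rw [e]
    refine Submodule.add_mem _ (Submodule.sum_mem _ fun j _ => Submodule.smul_mem _ _ ?_)
      (Submodule.smul_mem _ _ ?_)
    · exact Submodule.subset_span ⟨_, hI.update_mem_branch_zero hf j, rfl⟩
    · exact Submodule.subset_span ⟨_, hI.mem_branch_zero hf, rfl⟩
  | zero => simpa only [Pi.zero_apply, mul_zero] using! Submodule.zero_mem (code (branch I 0))
  | add c d _ _ hc hd => simpa only [Pi.add_apply, mul_add] using! Submodule.add_mem _ hc hd
  | smul r c _ hc =>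
    simpa only [Pi.smul_apply, smul_eq_mul, mul_left_comm] using! Submodule.smul_mem _ r hc

/-! ### Decoding and the addition of codewords -/

theorem mem_code_zero {I : Set (V 0)} {c : V 0 → ZMod 2} :
    c ∈ code I ↔ ∀ p, p ∉ I → c p = 0 := by
  obtain ⟨p⟩ : Nonempty (V 0) := ⟨default⟩
  by_cases hp : p ∈ I
  · refine iff_of_true ?_ fun q hq => absurd (Subsingleton.elim p q ▸ hp) hq
    have e : c = c p • evalMonomial p := by
      funext q
      simp [evalMonomial, Subsingleton.elim q p]
    rw [e]
    exact Submodule.smul_mem _ _ (Submodule.subset_span ⟨p, hp, rfl⟩)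
  · have hI : I = ∅ := Set.eq_empty_of_forall_notMem fun q hq => hp (Subsingleton.elim q p ▸ hq)
    subst hI
    simp [code, funext_iff]

theorem sc_mem_code {m : ℕ} (I : Set (V m)) (y : V m → ℝ) : sc I y ∈ code I := by
  induction m with
  | zero =>
    rw [mem_code_zero]
    intro p hp
    simp [sc, hp]
  | succ m ih =>
    rw [mem_code_succ, upperPart_sc, lowerPart_sc]
    exact ⟨ih _ _, ih _ _⟩

theorem upperLLR_sgn_mul {m : ℕ} (c : V (m + 1) → ZMod 2) (y : V (m + 1) → ℝ) :
    upperLLR (fun p => sgn (c p) * y p) = fun a => sgn (upperPart c a) * upperLLR y a := by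
  funext a
  exact fLLR_sgn_mul _ _ _ _

theorem lowerLLR_sgn_mul {m : ℕ} (c : V (m + 1) → ZMod 2) (u : V m → ZMod 2)
    (y : V (m + 1) → ℝ) :
    lowerLLR (u + upperPart c) (fun p => sgn (c p) * y p) =
      fun a => sgn (lowerPart c a) * lowerLLR u y a := by
  funext a
  simp only [lowerLLR, gLLR_eq, Pi.add_apply, eq_upperPart_lowerPart c, one_mul, zero_mul,
    zero_add, sgn_add]
  linear_combination sgn (u a) * sgn (lowerPart c a) * y (Fin.snoc a 1 : V (m + 1)) *
    sgn_mul_self (upperPart c a)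

/-- Away from ties, `SC_I` is equivariant under the addition of codewords. -/
theorem sc_sgn_mul {m : ℕ} {I : Set (V m)} {c : V m → ZMod 2} (hc : c ∈ code I) {y : V m → ℝ}
    (hy : TieFree I y) : TieFree I (fun p => sgn (c p) * y p) ∧
      sc I (fun p => sgn (c p) * y p) = sc I y + c := by
  induction m with
  | zero =>
    refine ⟨fun a ha => mul_ne_zero (sgn_ne_zero _) (hy a ha), ?_⟩
    funext p
    by_cases hp : p ∈ I
    · rcases zmod_two_cases (c p) with h | h
      · simp [sc, h, hp]
      · have hy' : y p ≠ 0 := hy p hp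
        rcases lt_or_gt_of_ne hy' with hlt | hgt
        · simp [sc, h, hp, hlt, hlt.le, CharTwo.add_self_eq_zero]
        · simp [sc, h, hp, hgt, hgt.le]
    · simp [sc, hp, mem_code_zero.1 hc p hp]
  | succ m ih =>
    obtain ⟨hu, hv⟩ := mem_code_succ.1 hc
    obtain ⟨h1, h0⟩ := (tieFree_succ I y).1 hy
    obtain ⟨t1, s1⟩ := ih hu h1
    obtain ⟨t0, s0⟩ := ih hv h0
    rw [← lowerLLR_sgn_mul] at t0 s0
    rw [tieFree_succ, upperLLR_sgn_mul, s1]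
    refine ⟨⟨t1, t0⟩, ?_⟩
    funext p
    rw [← Fin.snoc_init_self p, sc_snoc, upperLLR_sgn_mul, s1, s0, Pi.add_apply (sc I y) c, sc_snoc,
      eq_upperPart_lowerPart c]
    simp only [Pi.add_apply]
    ring

/-! ### Lower triangular maps commute with the decoder -/

/-- Lower triangular matrices with ones on the diagonal; over `𝔽₂` these are the invertible lower
triangular matrices. -/
structure IsLower {m : ℕ} (N : Matrix (Fin m) (Fin m) (ZMod 2)) : Prop where
  zero : ∀ i j, i < j → N i j = 0
  one : ∀ i, N i i = 1

theorem IsLower.submatrix {m : ℕ} {N : Matrix (Fin (m + 1)) (Fin (m + 1)) (ZMod 2)}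
    (hN : IsLower N) : IsLower (N.submatrix Fin.castSucc Fin.castSucc) where
  zero i j h := hN.zero _ _ (by simpa using h)
  one i := hN.one _

/-- A lower triangular map acts on the first `m` coordinates by a lower triangular map, and adds
an affine function of these coordinates to the last one. -/
theorem IsLower.mulVec_snoc {m : ℕ} {N : Matrix (Fin (m + 1)) (Fin (m + 1)) (ZMod 2)}
    (hN : IsLower N) (b : V (m + 1)) (a : V m) (z : ZMod 2) :
    N.mulVec (Fin.snoc a z : V (m + 1)) + b =
      (Fin.snoc ((N.submatrix Fin.castSucc Fin.castSucc).mulVec a + Fin.init b)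
        (z + (∑ j, N (Fin.last m) j.castSucc * a j + b (Fin.last m))) : V (m + 1)) := by
  funext i
  refine Fin.lastCases ?_ (fun i => ?_) i
  · simp only [Pi.add_apply, Matrix.mulVec, dotProduct, Fin.sum_univ_castSucc, Fin.snoc_castSucc,
      Fin.snoc_last, hN.one]
    ring
  · simp [Matrix.mulVec, dotProduct, Fin.sum_univ_castSucc, hN.zero _ _ (Fin.castSucc_lt_last i),
      Fin.init]

/-- Lower triangular affine maps are automorphisms of the codes of decreasing sets. -/
theorem comp_lower_mem_code {m : ℕ} {I : Set (V m)} (hI : ClosedUnderMoves I)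
    {N : Matrix (Fin m) (Fin m) (ZMod 2)} (hN : IsLower N) (b : V m) {c : V m → ZMod 2}
    (hc : c ∈ code I) : (fun a => c (N.mulVec a + b)) ∈ code I := by
  induction m with
  | zero =>
    have e : (fun a => c (N.mulVec a + b)) = c :=
      funext fun a => congrArg c (Subsingleton.elim _ _)
    rwa [e]
  | succ m ih =>
    obtain ⟨hu, hv⟩ := mem_code_succ.1 hc
    have hu' := ih (hI.branch 1) hN.submatrix (Fin.init b) hu
    have hv' := ih (hI.branch 0) hN.submatrix (Fin.init b) hv
    have hl := affine_mul_mem_code hI (fun j => N (Fin.last m) j.castSucc) (b (Fin.last m)) hu'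
    rw [mem_code_succ]
    constructor
    · convert hu' using 1
      funext a
      simp only [upperPart.eq_1 (fun a => c (N.mulVec a + b)), hN.mulVec_snoc,
        eq_upperPart_lowerPart c, zero_add]
      linear_combination CharTwo.add_self_eq_zero (lowerPart c
        ((N.submatrix Fin.castSucc Fin.castSucc).mulVec a + Fin.init b)) +
        (∑ j, N (Fin.last m) j.castSucc * a j + b (Fin.last m)) * CharTwo.add_self_eq_zero
        (upperPart c ((N.submatrix Fin.castSucc Fin.castSucc).mulVec a + Fin.init b))
    · convert Submodule.add_mem _ hl hv' using 1
      funext a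
      simp only [lowerPart.eq_1 (fun a => c (N.mulVec a + b)), hN.mulVec_snoc,
        eq_upperPart_lowerPart c, zero_add, Pi.add_apply]

theorem upperLLR_comp_lower {m : ℕ} {N : Matrix (Fin (m + 1)) (Fin (m + 1)) (ZMod 2)}
    (hN : IsLower N) (b : V (m + 1)) (y : V (m + 1) → ℝ) :
    upperLLR (fun p => y (N.mulVec p + b)) = fun a => upperLLR y
      ((N.submatrix Fin.castSucc Fin.castSucc).mulVec a + Fin.init b) := by
  funext a
  simp only [upperLLR, hN.mulVec_snoc]
  rcases zmod_two_cases (∑ j, N (Fin.last m) j.castSucc * a j + b (Fin.last m)) with h | h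
  · simp [h]
  · simp only [h, zero_add, CharTwo.add_self_eq_zero]
    exact fLLR_comm _ _

/-- Where a lower triangular map exchanges the two inputs of `g`, the output changes by the sign of
the bit that has been decided in the upper half branch. -/
theorem lowerLLR_comp_lower {m : ℕ} {N : Matrix (Fin (m + 1)) (Fin (m + 1)) (ZMod 2)}
    (hN : IsLower N) (b : V (m + 1)) (u : V m → ZMod 2) (y : V (m + 1) → ℝ) :
    lowerLLR (fun a => u ((N.submatrix Fin.castSucc Fin.castSucc).mulVec a + Fin.init b))
      (fun p => y (N.mulVec p + b)) =
    fun a => sgn ((∑ j, N (Fin.last m) j.castSucc * a j + b (Fin.last m)) *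
        u ((N.submatrix Fin.castSucc Fin.castSucc).mulVec a + Fin.init b)) *
      lowerLLR u y ((N.submatrix Fin.castSucc Fin.castSucc).mulVec a + Fin.init b) := by
  funext a
  simp only [lowerLLR, hN.mulVec_snoc, gLLR_eq]
  generalize (N.submatrix Fin.castSucc Fin.castSucc).mulVec a + Fin.init b = q
  rcases zmod_two_cases (∑ j, N (Fin.last m) j.castSucc * a j + b (Fin.last m)) with h | h
  · simp [h]
  · simp only [h, zero_add, CharTwo.add_self_eq_zero, one_mul]
    linear_combination -y (Fin.snoc q 1 : V (m + 1)) * sgn_mul_self (u q)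

/-- Lower triangular affine maps preserve tie-freeness and commute with `SC_I`. -/
theorem sc_comp_lower {m : ℕ} {I : Set (V m)} (hI : ClosedUnderMoves I)
    {N : Matrix (Fin m) (Fin m) (ZMod 2)} (hN : IsLower N) (b : V m) {y : V m → ℝ}
    (hy : TieFree I y) : TieFree I (fun p => y (N.mulVec p + b)) ∧
      sc I (fun p => y (N.mulVec p + b)) = fun p => sc I y (N.mulVec p + b) := by
  induction m with
  | zero =>
    have e : (fun p => y (N.mulVec p + b)) = y :=
      funext fun p => congrArg y (Subsingleton.elim _ _)
    rw [e]
    exact ⟨hy, funext fun p => congrArg (sc I y) (Subsingleton.elim _ _)⟩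
  | succ m ih =>
    obtain ⟨h1, h0⟩ := (tieFree_succ I y).1 hy
    obtain ⟨t1, s1⟩ := ih (hI.branch 1) hN.submatrix (Fin.init b) h1
    obtain ⟨t0, s0⟩ := ih (hI.branch 0) hN.submatrix (Fin.init b) h0
    have hl := affine_mul_mem_code hI (fun j => N (Fin.last m) j.castSucc) (b (Fin.last m))
      (sc_mem_code (branch I 1)
        fun a => upperLLR y ((N.submatrix Fin.castSucc Fin.castSucc).mulVec a + Fin.init b))
    rw [s1] at hl
    obtain ⟨t0', s0'⟩ := sc_sgn_mul hl t0
    rw [← lowerLLR_comp_lower hN] at t0' s0'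
    rw [tieFree_succ, upperLLR_comp_lower hN, s1]
    refine ⟨⟨t1, t0'⟩, ?_⟩
    funext p
    rw [← Fin.snoc_init_self p, sc_snoc, upperLLR_comp_lower hN, s1, s0', s0, hN.mulVec_snoc,
      sc_snoc]
    simp only [Pi.add_apply]
    ring

open Matrix

/-! ### Groups of matrices that contain the lower triangular ones -/

theorem IsLower.of_one_add {m : ℕ} {N : Matrix (Fin m) (Fin m) (ZMod 2)}
    (h : ∀ i j, i ≤ j → N i j = 0) : IsLower (1 + N) where
  zero i j hij := by simp [h i j hij.le, hij.ne]
  one i := by simp [h i i le_rfl]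

theorem IsLower.transvection {m : ℕ} {i j : Fin m} (h : j < i) :
    IsLower (transvection i j (1 : ZMod 2)) :=
  .of_one_add fun a b hab => by
    rw [Matrix.single_apply, if_neg]
    rintro ⟨rfl, rfl⟩
    exact absurd hab (not_le.2 h)

theorem IsLower.isUnit_det {m : ℕ} {N : Matrix (Fin m) (Fin m) (ZMod 2)} (hN : IsLower N) :
    IsUnit N.det := by
  rw [det_of_isLowerTriangular N fun i j h => hN.zero i j h,
    Finset.prod_congr rfl fun i _ => hN.one i, Finset.prod_const_one]
  exact isUnit_one

/-- The Bruhat decomposition: lower triangular factors on both sides turn every invertible matrix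
into a permutation matrix.  It is phrased for a set `S` that is closed under such factors, a union of
double cosets, so that the factors need not be recorded. -/
theorem exists_permMatrix_mem {m : ℕ} {S : Set (Matrix (Fin m) (Fin m) (ZMod 2))}
    (hunit : ∀ X ∈ S, IsUnit X.det) (hleft : ∀ L X, IsLower L → X ∈ S → L * X ∈ S)
    (hright : ∀ L X, IsLower L → X ∈ S → X * L ∈ S) (hS : S.Nonempty) :
    ∃ σ : Equiv.Perm (Fin m), σ.permMatrix (ZMod 2) ∈ S := by
  -- Clear the rows from the top to the bottom, each with its rightmost nonzero entry as the pivot.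
  have key (k : ℕ) (hk : k ≤ m) : ∃ X ∈ S, ∀ i : Fin m, i.val < k → ∃ j,
      (∀ b, X i b = if b = j then 1 else 0) ∧ ∀ a, X a j = if a = i then 1 else 0 := by
    induction k with
    | zero => exact ⟨hS.some, hS.some_mem, fun i hi => absurd hi (Nat.not_lt_zero _)⟩
    | succ k ih =>
      obtain ⟨X, hX, hp⟩ := ih (by omega)
      let r : Fin m := ⟨k, hk⟩
      have hne : ∃ b, X r b ≠ 0 := by
        by_contra! h
        exact (hunit X hX).ne_zero (det_eq_zero_of_row_eq_zero r h)
      obtain ⟨j, hj, hmax⟩ := (Finset.univ.filter fun b => X r b ≠ 0).exists_max_image id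
        (by simpa [Finset.Nonempty] using hne)
      have hj1 : X r j = 1 := (zmod_two_cases _).resolve_left (by simpa using hj)
      have hj0 (b : Fin m) (hb : j < b) : X r b = 0 := by
        by_contra h
        exact absurd (hmax b (by simpa using h)) (not_le.2 hb)
      have hrow (a : Fin m) (ha : a < r) : X a j = 0 := by
        obtain ⟨c, h1, h2⟩ := hp a ha
        rw [h1, if_neg]
        rintro rfl
        rw [h2, if_neg ha.ne'] at hj1
        exact zero_ne_one hj1
      let R : Matrix (Fin m) (Fin m) (ZMod 2) :=
        of fun a b => if a = j then (if b = j then 0 else X r b) else 0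
      have hR : IsLower (1 + R) := .of_one_add fun a b hab => by
        simp only [R, of_apply]
        split_ifs with h1 h2
        · rfl
        · exact hj0 b (lt_of_le_of_ne (h1 ▸ hab) (Ne.symm h2))
        · rfl
      have hY (a b : Fin m) : (X * (1 + R)) a b =
          X a b + if b = j then 0 else X a j * X r b := by
        rw [mul_add, mul_one, Matrix.add_apply, mul_apply]
        simp only [R, of_apply, mul_ite, mul_zero, Finset.sum_ite_eq', Finset.mem_univ, if_true]
      have hYX := hright _ _ hR hX
      generalize X * (1 + R) = Y at hY hYX
      have hYr (b : Fin m) : Y r b = if b = j then 1 else 0 := by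
        rw [hY]
        split_ifs with h
        · rw [h, hj1, add_zero]
        · rw [hj1, one_mul, CharTwo.add_self_eq_zero]
      let L : Matrix (Fin m) (Fin m) (ZMod 2) :=
        of fun a b => if b = r then (if a = r then 0 else Y a j) else 0
      have hL : IsLower (1 + L) := .of_one_add fun a b hab => by
        simp only [L, of_apply]
        split_ifs with h1 h2
        · rfl
        · rw [hY, if_pos rfl, add_zero]
          exact hrow a (lt_of_le_of_ne (h1 ▸ hab) h2)
        · rfl
      have hZ (a b : Fin m) : ((1 + L) * Y) a b =
          Y a b + if a = r then 0 else if b = j then Y a j else 0 := by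
        rw [add_mul, one_mul, Matrix.add_apply, mul_apply]
        simp only [L, of_apply, ite_mul, zero_mul, Finset.sum_ite_eq',
          Finset.mem_univ, if_true, hYr, mul_ite, mul_one, mul_zero]
      refine ⟨(1 + L) * Y, hleft _ _ hL hYX, fun i hi => ?_⟩
      rcases (Nat.lt_succ_iff_lt_or_eq.1 hi) with hi | hi
      · obtain ⟨c, h1, h2⟩ := hp i hi
        have hir : i ≠ r := fun h => by simp [h, r] at hi
        have hcj : c ≠ j := by
          rintro rfl
          rw [h2, if_neg hir.symm] at hj1
          exact zero_ne_one hj1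
        have hij : X i j = 0 := by rw [h1, if_neg hcj.symm]
        refine ⟨c, fun b => ?_, fun a => ?_⟩
        · rw [hZ, hY, hY, ← h1]
          simp [hij]
        · rw [hZ, hY, if_neg hcj, if_neg hcj, h2 r, if_neg hir.symm, h2]
          simp
      · obtain rfl : i = r := Fin.ext hi
        refine ⟨j, fun b => ?_, fun a => ?_⟩
        · rw [hZ, if_pos rfl, add_zero, hYr]
        · rw [hZ]
          rcases eq_or_ne a r with rfl | h
          · rw [hYr, if_pos rfl, if_pos rfl, if_pos rfl, add_zero]
          · rw [if_neg h, if_neg h, if_pos rfl, CharTwo.add_self_eq_zero]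
  obtain ⟨X, hX, h⟩ := key m le_rfl
  choose σ h1 h2 using fun i : Fin m => h i i.2
  have hσ : Function.Injective σ := fun a b hab => by
    have := h2 a b
    rw [hab, h2 b b, if_pos rfl] at this
    by_contra hne
    rw [if_neg (Ne.symm hne)] at this
    exact one_ne_zero this
  refine ⟨Equiv.ofBijective σ (Finite.injective_iff_bijective.1 hσ), ?_⟩
  convert hX using 1
  ext a b
  rw [h1]
  simp [Equiv.Perm.permMatrix, PEquiv.toMatrix_apply, eq_comm]

theorem transvection_mul_self {m : ℕ} {i j : Fin m} (h : i ≠ j) :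
    transvection i j (1 : ZMod 2) * transvection i j 1 = 1 := by
  rw [transvection_mul_transvection_same _ _ h, CharTwo.add_self_eq_zero, transvection_zero]

/-- The commutator of two elementary matrices. -/
theorem transvection_commutator {m : ℕ} {i j k : Fin m} (hij : i ≠ j) (hjk : j ≠ k) (hik : i ≠ k) :
    transvection i j (1 : ZMod 2) * transvection j k 1 * transvection i j 1 * transvection j k 1 =
      transvection i k 1 := by
  have h : transvection i j (1 : ZMod 2) * transvection j k 1 =
      transvection i k 1 * transvection j k 1 * transvection i j 1 := by
    simp only [transvection, add_mul, mul_add, one_mul, mul_one, single_mul_single_same]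
    simp only [single_mul_single_of_ne _ _ _ _ hjk.symm, single_mul_single_of_ne _ _ _ _ hik.symm,
      zero_mul, add_zero]
    abel
  rw [h, mul_assoc _ (transvection i j 1) (transvection i j 1), transvection_mul_self hij, mul_one,
    mul_assoc, transvection_mul_self hjk, mul_one]

/-- Three elementary matrices exchange two rows. -/
theorem transvection_mul_permMatrix {m : ℕ} {i j : Fin m} (hij : i ≠ j) (τ : Equiv.Perm (Fin m)) :
    transvection i j (1 : ZMod 2) * (transvection j i 1 * (transvection i j 1 *
      τ.permMatrix (ZMod 2))) = (τ * Equiv.swap i j).permMatrix (ZMod 2) := by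
  have hs (a b : Fin m) : (τ * Equiv.swap i j).permMatrix (ZMod 2) a b =
      τ.permMatrix (ZMod 2) (Equiv.swap i j a) b := by
    simp [Equiv.Perm.permMatrix, PEquiv.toMatrix_apply]
  ext a b
  rw [hs]
  generalize τ.permMatrix (ZMod 2) = W
  have h2 (x y : ZMod 2) : x + y + x = y ∧ y + (x + y) = x := by
    revert x y; decide
  rcases eq_or_ne a i with rfl | hi
  · simp only [Equiv.swap_apply_left, transvection_mul_apply_same, one_mul, ne_eq, hij, hij.symm,
      transvection_mul_apply_of_ne, not_false_eq_true, h2]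
  · rcases eq_or_ne a j with rfl | hj
    · simp only [Equiv.swap_apply_right, transvection_mul_apply_same, one_mul, ne_eq, hi,
        transvection_mul_apply_of_ne, not_false_eq_true, h2]
    · simp [hi, hj, Equiv.swap_apply_of_ne_of_ne]

theorem permMatrix_mul_transvection {m : ℕ} (τ : Equiv.Perm (Fin m)) (i j : Fin m) :
    τ.permMatrix (ZMod 2) * transvection (τ i) (τ j) 1 =
      transvection i j 1 * τ.permMatrix (ZMod 2) := by
  have h : τ.permMatrix (ZMod 2) * single (τ i) (τ j) 1 = single i j 1 * τ.permMatrix (ZMod 2) := by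
    ext a b
    rw [Equiv.Perm.permMatrix, PEquiv.toMatrix_toPEquiv_mul, PEquiv.mul_toMatrix_toPEquiv]
    simp [single_apply, Equiv.eq_symm_apply]
  simp only [transvection, mul_add, add_mul, mul_one, one_mul, h]

/-- A submonoid of a finite matrix ring is closed under inversion, since inverses are powers. -/
theorem inv_mem_of_isUnit_det {m : ℕ} {H : Submonoid (Matrix (Fin m) (Fin m) (ZMod 2))}
    {X : Matrix (Fin m) (Fin m) (ZMod 2)} (hX : IsUnit X.det) (h : X ∈ H) : X⁻¹ ∈ H := by
  obtain ⟨u, rfl⟩ := (isUnit_iff_isUnit_det X).2 hX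
  have e : (u : Matrix (Fin m) (Fin m) (ZMod 2)) ^ (orderOf u - 1) * u = 1 := by
    rw [← pow_succ, Nat.sub_add_cancel (orderOf_pos u), ← Units.val_pow_eq_pow_val,
      pow_orderOf_eq_one, Units.val_one]
  rw [inv_eq_left_inv e]
  exact H.pow_mem h _

/-- Inclusions between groups of matrices over `𝔽₂` that contain the lower triangular ones can be
tested on the elementary matrices. -/
theorem le_of_transvection_mem {m : ℕ} {H H' : Submonoid (Matrix (Fin m) (Fin m) (ZMod 2))}
    (hunit : ∀ X ∈ H, IsUnit X.det)
    (hlow : ∀ X, IsLower X → X ∈ H) (hlow' : ∀ X, IsLower X → X ∈ H')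
    (h : ∀ i j, i < j → transvection i j (1 : ZMod 2) ∈ H → transvection i j (1 : ZMod 2) ∈ H') :
    H ≤ H' := by
  intro M hM
  obtain ⟨σ, hσ⟩ := exists_permMatrix_mem (S := {X | X ∈ H ∧ (X ∈ H' → M ∈ H')})
    (fun X hX => hunit X hX.1)
    (fun L X hL hX => ⟨H.mul_mem (hlow _ hL) hX.1, fun hLX => hX.2 (by
      simpa [← mul_assoc, nonsing_inv_mul _ hL.isUnit_det] using
        H'.mul_mem (inv_mem_of_isUnit_det hL.isUnit_det (hlow' _ hL)) hLX)⟩)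
    (fun L X hL hX => ⟨H.mul_mem hX.1 (hlow _ hL), fun hLX => hX.2 (by
      simpa [mul_assoc, mul_nonsing_inv _ hL.isUnit_det] using
        H'.mul_mem hLX (inv_mem_of_isUnit_det hL.isUnit_det (hlow' _ hL)))⟩)
    ⟨M, hM, id⟩
  -- Sort the permutation; an inversion at `i < j` turns a lower elementary matrix into the upper
  -- one at `(i, j)`, which thus belongs to both groups, as does the transposition of `i` and `j`.
  have hsort := Tuple.bubble_sort_induction' (f := σ)
    (P := fun f => ∀ τ : Equiv.Perm (Fin m), τ = f → τ.permMatrix (ZMod 2) ∈ H ∧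
      (τ.permMatrix (ZMod 2) ∈ H' → M ∈ H'))
    (fun τ hτ => by rwa [DFunLike.coe_injective hτ])
    (fun ρ i j hij hinvr hP τ' hτ' => by
      obtain ⟨hτ, hτM⟩ := hP (σ * ρ) rfl
      obtain rfl : τ' = (σ * ρ) * Equiv.swap i j := DFunLike.coe_injective hτ'
      have hinvr : (σ * ρ) j < (σ * ρ) i := hinvr
      generalize σ * ρ = τ at *
      have hdet := hunit _ hτ
      have hE : transvection i j (1 : ZMod 2) ∈ H := by
        have := H.mul_mem (H.mul_mem hτ (hlow _ (IsLower.transvection hinvr)))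
          (inv_mem_of_isUnit_det hdet hτ)
        rwa [permMatrix_mul_transvection, mul_assoc, mul_nonsing_inv _ hdet, mul_one] at this
      have hE' := h i j hij hE
      have hF := hlow _ (IsLower.transvection hij)
      have hF' := hlow' _ (IsLower.transvection hij)
      refine ⟨?_, fun hs => hτM ?_⟩
      · rw [← transvection_mul_permMatrix hij.ne]
        exact H.mul_mem hE (H.mul_mem hF (H.mul_mem hE hτ))
      · have := H'.mul_mem hE' (H'.mul_mem hF' (H'.mul_mem hE' hs))
        rwa [transvection_mul_permMatrix hij.ne, mul_assoc, Equiv.swap_mul_self, mul_one] at this)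
  obtain ⟨-, hM'⟩ := hsort (σ * Tuple.sort σ) rfl
  rw [(Equiv.Perm.monotone_iff (σ * Tuple.sort σ)).1 (Tuple.monotone_sort σ)] at hM'
  exact hM' (by simp)

/-! ### Groups of affine permutations that contain the lower triangular ones -/

theorem affinePerm_apply {m : ℕ} (M : GeneralLinearGroup (Fin m) (ZMod 2)) (b a : V m) :
    affinePerm M b a = M.1.mulVec a + b := rfl

theorem affinePerm_mul {m : ℕ} (M N : GeneralLinearGroup (Fin m) (ZMod 2)) (b c : V m) :
    affinePerm M b * affinePerm N c = affinePerm (M * N) (M.1.mulVec c + b) := by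
  ext1 a
  simp [affinePerm, mulVec_add, add_assoc]

theorem affinePerm_one {m : ℕ} : affinePerm (1 : GeneralLinearGroup (Fin m) (ZMod 2)) 0 = 1 := by
  ext1 a
  simp [affinePerm]

theorem linearPart_unique {m : ℕ} {M N : GeneralLinearGroup (Fin m) (ZMod 2)} {b c : V m}
    (h : affinePerm M b = affinePerm N c) : M.1 = N.1 := by
  have hb : b = c := by simpa [affinePerm_apply] using congrArg (fun π => π 0) h
  refine Matrix.toLin'.injective (LinearMap.ext fun a => ?_)
  simpa [affinePerm_apply, hb] using congrArg (fun π => π a) h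

/-- The linear parts of the affine permutations in a monoid. -/
def linearParts {m : ℕ} (G : Submonoid (Equiv.Perm (V m))) :
    Submonoid (Matrix (Fin m) (Fin m) (ZMod 2)) where
  carrier := {X | ∃ M b, M.1 = X ∧ affinePerm M b ∈ G}
  one_mem' := ⟨1, 0, rfl, affinePerm_one ▸ G.one_mem⟩
  mul_mem' := by
    rintro _ _ ⟨M, b, rfl, hM⟩ ⟨N, c, rfl, hN⟩
    exact ⟨M * N, _, rfl, affinePerm_mul M N b c ▸ G.mul_mem hM hN⟩

/-- As translations are lower triangular, membership only depends on the linear part. -/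
theorem affinePerm_mem_of_mem_linearParts {m : ℕ} {G : Submonoid (Equiv.Perm (V m))}
    (hG : ∀ M b, IsLower M.1 → affinePerm M b ∈ G) {M : GeneralLinearGroup (Fin m) (ZMod 2)}
    (b : V m) (hM : M.1 ∈ linearParts G) : affinePerm M b ∈ G := by
  obtain ⟨N, c, hNM, hN⟩ := hM
  obtain rfl : N = M := Units.ext hNM
  have h1 : IsLower (1 : GeneralLinearGroup (Fin m) (ZMod 2)).1 :=
    ⟨fun i j h => Matrix.one_apply_ne h.ne, fun i => Matrix.one_apply_eq i⟩
  have := G.mul_mem (hG 1 (b - c) h1) hN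
  rwa [affinePerm_mul, one_mul, Units.val_one, one_mulVec, add_sub_cancel] at this

theorem mem_linearParts_of_isLower {m : ℕ} {G : Submonoid (Equiv.Perm (V m))}
    (hG : ∀ M b, IsLower M.1 → affinePerm M b ∈ G) {X : Matrix (Fin m) (Fin m) (ZMod 2)}
    (hX : IsLower X) : X ∈ linearParts G := by
  obtain ⟨u, rfl⟩ := (isUnit_iff_isUnit_det X).2 hX.isUnit_det
  exact ⟨u, 0, rfl, hG u 0 hX⟩

theorem le_of_transvection_mem_linearParts {m : ℕ} {G G' : Submonoid (Equiv.Perm (V m))}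
    (haff : ∀ π ∈ G, ∃ M b, π = affinePerm M b)
    (hG : ∀ M b, IsLower M.1 → affinePerm M b ∈ G) (hG' : ∀ M b, IsLower M.1 → affinePerm M b ∈ G')
    (h : ∀ i j, i < j → transvection i j 1 ∈ linearParts G →
      transvection i j 1 ∈ linearParts G') : G ≤ G' := by
  intro π hπ
  obtain ⟨M, b, rfl⟩ := haff π hπ
  refine affinePerm_mem_of_mem_linearParts hG' b
    (le_of_transvection_mem ?_ (fun _ => mem_linearParts_of_isLower hG)
      (fun _ => mem_linearParts_of_isLower hG') h ⟨M, b, rfl, hπ⟩)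
  rintro _ ⟨N, c, rfl, -⟩
  exact (isUnit_iff_isUnit_det N.1).1 N.isUnit

/-- Two positions lie in different blocks iff a boundary separates them. -/
theorem index_lt_index_iff {m : ℕ} (s : Composition m) (i j : Fin m) :
    s.index i < s.index j ↔ ∃ k ∈ s.boundaries, i.val < k.val ∧ k.val ≤ j.val := by
  constructor
  · intro h
    refine ⟨s.boundary (s.index i).succ, Finset.mem_map_of_mem _ (Finset.mem_univ _),
      s.lt_sizeUpTo_index_succ i, ?_⟩
    exact (s.monotone_sizeUpTo (Nat.succ_le_of_lt h)).trans (s.sizeUpTo_index_le j)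
  · rintro ⟨k, hk, hik, hkj⟩
    obtain ⟨t, -, rfl⟩ := Finset.mem_map.1 hk
    change i.val < s.sizeUpTo t at hik
    change s.sizeUpTo t ≤ j.val at hkj
    by_contra! hji
    rcases Nat.lt_or_ge (s.index j) t with ht | ht
    · exact absurd (s.lt_sizeUpTo_index_succ j) (not_lt.2
        ((s.monotone_sizeUpTo (Nat.succ_le_of_lt ht)).trans hkj))
    · exact absurd hik (not_lt.2
        ((s.monotone_sizeUpTo (ht.trans hji)).trans (s.sizeUpTo_index_le i)))

theorem affinePerm_mem_BLTA_of_isLower {m : ℕ} (s : Composition m)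
    (M : GeneralLinearGroup (Fin m) (ZMod 2)) (b : V m) (hM : IsLower M.1) :
    affinePerm M b ∈ BLTA s := by
  refine ⟨M, b, fun i j h => hM.zero i j ?_, rfl⟩
  obtain ⟨k, -, hik, hkj⟩ := (index_lt_index_iff s i j).1 h
  exact Fin.lt_def.2 (hik.trans_le hkj)

/-- An elementary matrix belongs to the group if each place between its row and its column is
crossed by some elementary matrix of the group: lower triangular factors shorten the latter, and
commutators join them. -/
theorem transvection_mem_of_crossings {m : ℕ} {H : Submonoid (Matrix (Fin m) (Fin m) (ZMod 2))}
    (hlow : ∀ X, IsLower X → X ∈ H) (i j : Fin m) (hij : i < j)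
    (h : ∀ k, i < k → k ≤ j → ∃ a b, a < k ∧ k ≤ b ∧ transvection a b (1 : ZMod 2) ∈ H) :
    transvection i j (1 : ZMod 2) ∈ H := by
  induction j using WellFoundedLT.induction with
  | ind j ih =>
  have mul {a b c : Fin m} (hab : a ≠ b) (hbc : b ≠ c) (hac : a ≠ c)
      (h1 : transvection a b (1 : ZMod 2) ∈ H) (h2 : transvection b c (1 : ZMod 2) ∈ H) :
      transvection a c (1 : ZMod 2) ∈ H := by
    rw [← transvection_commutator hab hbc hac]
    exact H.mul_mem (H.mul_mem (H.mul_mem h1 h2) h1) h2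
  obtain ⟨a, b, haj, hjb, hab⟩ := h j hij le_rfl
  have haj' : transvection a j (1 : ZMod 2) ∈ H := by
    rcases hjb.eq_or_lt with rfl | hjb
    · exact hab
    · exact mul (haj.trans hjb).ne hjb.ne' haj.ne hab (hlow _ (.transvection hjb))
  rcases lt_trichotomy i a with hia | rfl | hai
  · exact mul hia.ne haj.ne hij.ne
      (ih a haj hia fun k hik hka => h k hik (hka.trans haj.le)) haj'
  · exact haj'
  · exact mul hai.ne' haj.ne hij.ne (hlow _ (.transvection hai)) haj'

/-- The groups of affine permutations that contain the lower triangular ones are the groups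
`BLTA s`; a boundary between two blocks is a place that no elementary matrix in the group
crosses. -/
theorem exists_eq_BLTA {m : ℕ} (G : Submonoid (Equiv.Perm (V m)))
    (haff : ∀ π ∈ G, ∃ M b, π = affinePerm M b)
    (hG : ∀ M b, IsLower M.1 → affinePerm M b ∈ G) :
    ∃ s : Composition m, (G : Set (Equiv.Perm (V m))) = BLTA s := by
  classical
  let c : CompositionAsSet m :=
    { boundaries := Finset.univ.filter fun k => ∀ a b : Fin m, a.val < k.val → k.val ≤ b.val →
        transvection a b (1 : ZMod 2) ∉ linearParts G
      zero_mem := by simp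
      getLast_mem := by
        simp only [Finset.mem_filter_univ]
        intro a b _ hb
        exact absurd b.2 (not_lt.2 hb) }
  have hc (k : Fin (m + 1)) : k ∈ c.toComposition.boundaries ↔ ∀ a b : Fin m, a.val < k.val →
      k.val ≤ b.val → transvection a b (1 : ZMod 2) ∉ linearParts G := by
    rw [CompositionAsSet.toComposition_boundaries]
    simp [c]
  generalize c.toComposition = s at hc
  refine ⟨s, congrArg SetLike.coe (?_ : G = (BLTA s).toSubmonoid)⟩
  apply le_antisymm
  · refine le_of_transvection_mem_linearParts haff hG (affinePerm_mem_BLTA_of_isLower s)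
      fun i j hij h => ?_
    obtain ⟨u, hu⟩ := (isUnit_iff_isUnit_det (transvection i j (1 : ZMod 2))).2
      (by rw [det_transvection_of_ne i j hij.ne]; exact isUnit_one)
    refine ⟨u, 0, hu, u, 0, fun a b hab => ?_, rfl⟩
    obtain ⟨k, hk, hak, hkb⟩ := (index_lt_index_iff s a b).1 hab
    rw [hu, transvection, Matrix.add_apply, Matrix.one_apply_ne (by rintro rfl; omega), zero_add,
      single_apply, if_neg]
    rintro ⟨rfl, rfl⟩
    exact (hc k).1 hk i j hak hkb h
  · refine le_of_transvection_mem_linearParts ?_ (affinePerm_mem_BLTA_of_isLower s) hG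
      fun i j hij h => ?_
    · rintro _ ⟨M, b, -, rfl⟩
      exact ⟨M, b, rfl⟩
    · obtain ⟨M, b, hM, N, b', hN, hMN⟩ := h
      refine transvection_mem_of_crossings (fun _ => mem_linearParts_of_isLower hG) i j hij
        fun k hik hkj => ?_
      by_contra! hk
      have hlt : s.index i < s.index j := (index_lt_index_iff s i j).2
        ⟨k.castSucc, (hc _).2 fun a b ha hb => hk a b ha hb, hik, hkj⟩
      have := hN i j hlt
      rw [← linearPart_unique hMN, hM] at this
      simp [transvection, hij.ne] at this

/-! ### The affine automorphisms that commute with the decoder -/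

theorem mul_mem_affineAut {m : ℕ} {I : Set (V m)} {π ρ : Equiv.Perm (V m)} (hπ : π ∈ affineAut I)
    (hρ : ρ ∈ affineAut I) : π * ρ ∈ affineAut I := by
  obtain ⟨⟨M, b, rfl⟩, hπ⟩ := hπ
  obtain ⟨⟨N, c, rfl⟩, hρ⟩ := hρ
  exact ⟨⟨_, _, affinePerm_mul M N b c⟩, fun w hw => hρ _ (hπ w hw)⟩

/-- The affine automorphisms that commute with `SC_I`, as a monoid. -/
def scMonoid {m : ℕ} (I : Set (V m)) : Submonoid (Equiv.Perm (V m)) where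
  carrier := scClass I 1
  one_mem' := ⟨⟨⟨1, 0, affinePerm_one.symm⟩, fun _ hc => hc⟩, fun _ _ _ => rfl⟩
  mul_mem' := by
    intro π ρ hπ hρ
    rw [mem_scClass_one_iff] at *
    exact ⟨mul_mem_affineAut hπ.1 hρ.1, commutesWithSC_mul hπ.2 hρ.2⟩

theorem affinePerm_mem_scMonoid_of_isLower {m : ℕ} {I : Set (V m)} (hI : IsDecreasing I)
    (M : GeneralLinearGroup (Fin m) (ZMod 2)) (b : V m) (hM : IsLower M.1) :
    affinePerm M b ∈ scMonoid I :=
  (mem_scClass_one_iff I _).2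
    ⟨⟨⟨M, b, rfl⟩, fun _ hc => comp_lower_mem_code hI.closedUnderMoves hM b hc⟩,
      fun _ hy _ => (sc_comp_lower hI.closedUnderMoves hM b hy).2⟩

end PolarSC

theorem theorem3 (m : ℕ) (I : Set (PolarSC.V m)) (hI : PolarSC.IsDecreasing I) :
    ∃ s : Composition m,
      PolarSC.scClass I 1 = (PolarSC.BLTA s : Set (Equiv.Perm (PolarSC.V m))) :=
  PolarSC.exists_eq_BLTA (PolarSC.scMonoid I) (fun _ hπ => hπ.1.1)
    (PolarSC.affinePerm_mem_scMonoid_of_isLower hI)
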